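/- **Setting.** Let $\mathcal S,\mathcal A$ be finite, $\gamma\in[0,1)$, $\varrho>0$, $T,M\ge 1$. For $t=1,\dots,T$, task $t$ is a constrained MDP with initial distribution $\rho_t$, transition kernel $P_t$, reward $c_{t,0}$ and costs $c_{t,1},\dots,c_{t,p}$ with values in $[0,1]$, and limits $d_{t,i}$. Write $J_{t,i}(\pi)$ for the expected $\gamma$-discounted total of $c_{t,i}$ under a policy $\pi$ started from $\rho_t$, and $Q^i_{t,\pi}$ for the corresponding action-value function. Let $\pi_t^*$ be a policy maximizing $J_{t,0}$ subject to $J_{t,i}\le d_{t,i}$ ($1\le i\le p$), and $\nu_t^*$ its normalized discounted state visitation distribution. Let $X=\Delta\mathcal A_\varrho^{|\mathcal S|}$ be the set of policies all of whose action probabilities are at least $\varrho$, with the Euclidean norm of $\mathbb R^{\mathcal S\times\mathcal A}$. **Algorithm.** In task $t$, CRPO (softmax parametrization, exact critic, learning rate $\alpha$, tolerance $\eta_t$) is started at $\pi_{t,0}=\phi_t$ and run for $M$ steps. If $J_{t,i}(\pi_{t,m})\le d_{t,i}+\eta_t$ for all $i=1,\dots,p$, then $m$ belongs to the set $\mathcal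 N_{t,0}$ of reward steps and $\theta_{m+1}=\theta_m+\frac{\alpha}{1-\gamma}Q^0_{t,\pi_{t,m}}$; otherwise $\theta_{m+1}=\theta_m-\frac{\alpha}{1-\gamma}Q^i_{t,\pi_{t,m}}$ for some $i\geq 1$ with $J_{t,i}(\pi_{t,m})>d_{t,i}+\eta_t$. The output $\hat\pi_t$ is drawn uniformly from $\{\pi_{t,m}:m\in\mathcal N_{t,0}\}$, and $\hat\nu_t$ is any estimated state distribution. The initializations are obtained by inexact online gradient descent: $\phi_1=P_X(0)$ and $\phi_{t+1}=P_X\big(\phi_t-\beta\nabla \hat f_t(\phi_t)\big)$, where $\hat f_t(\phi)=\mathbb E_{s\sim\hat\nu_t}[D_{KL}(\hat\pi_t(\cdot|s)|\phi(\cdot|s))]$ estimates $f_t(\phi)=\mathbb E_{s\sim\nu_t^*}[D_{KL}(\pi^*_t(\cdot|s)|\phi(\cdot|s))]$. **Quantities.** Let $\epsilon_t$ be any numbers with $\sup_{\phi\in X}|f_t(\phi)-\hat f_t(\phi)|\le\epsilon_t$ and let $\mathcal E_T=\sum_{t}\epsilon_t$. Let $\hat D^{*2}=\min_{\phi\in X}\frac1T\sum_{t}\hat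 f_t(\phi)$, attained at $\phi^*$. Let $L_g,L_\pi>0$ be such that, for all $t,s$, the maps $D_{KL}(\pi_t^*(\cdot|s)|\cdot)$ and $D_{KL}(\hat\pi_t(\cdot|s)|\cdot)$ are $L_g$-Lipschitz and $L_\pi$-smooth on $\Delta\mathcal A_\varrho$ (for instance $L_g=1/\varrho$, $L_\pi=1/\varrho^2$), and let $0<C_1<2/L_\pi$. Put $$B=\frac{\sqrt2L_g\|\phi^*\|}{\sqrt T}+\Big(2+\frac{4\sqrt2L_gL_\pi\|\phi^*\|}{(2C_1-C_1^2L_\pi)\sqrt T}\Big)\frac{\mathcal E_T}{T}+\hat D^{*2},\qquad \kappa=\max\Big\{\frac{|\mathcal S||\mathcal A|}{(1-\gamma)^3},\frac1{16(1-\gamma)^4}\Big\}.$$ **Theorem.** Suppose that $\alpha=\sqrt{B/(2M\kappa)}$, $\beta=\|\phi^*\|/(L_g\sqrt{2T})$ and, for some $\lambda\ge1$, $\eta_t=\frac{\lambda}{\alpha M}\big(f_t(\phi_t)+2M\alpha^2\kappa\big)$ for every $t$. Then $\mathcal N_{t,0}\ne\emptyset$ for every $t$ (so that the outputs are well defined),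 and the task-averaged optimality gap $\bar R_0=\frac1T\sum_t\big(J_{t,0}(\pi_t^*)-\mathbb E[J_{t,0}(\hat\pi_t)]\big)$ and the task-averaged constraint violations $\bar R_i=\frac1T\sum_t\big(\mathbb E[J_{t,i}(\hat\pi_t)]-d_{t,i}\big)$, $1\le i\le p$, satisfy $$\bar R_i\le\lambda\,\frac{\sqrt{8\kappa}}{\sqrt M}\,\sqrt B\qquad(i=0,1,\dots,p),$$ for every realization of the outputs and estimates; here $\mathbb E[J_{t,i}(\hat\pi_t)]=\frac1{|\mathcal N_{t,0}|}\sum_{m\in\mathcal N_{t,0}}J_{t,i}(\pi_{t,m})$ is the expectation over the uniform draw of the output in task $t$, given its initialization $\phi_t$. In particular $\bar R_i=O\big(\frac1{\sqrt M}\sqrt{\frac1{\sqrt T}+\frac{\mathcal E_T}T+\hat D^{*2}}\big)$, with constants depending only on $|\mathcal S|,|\mathcal A|,\gamma,L_g,L_\pi,C_1,\lambda$. -/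

import Mathlib

noncomputable section

namespace MetaSRL

/-- Tables `S → ℝ^A`, with the Euclidean norm of `ℝ^(S × A)`; policies are the members of
`shrunkPolicies 0`, and `π s a` is the probability of action `a` in state `s`. -/
abbrev Table (S A : Type*) [Fintype S] [Fintype A] : Type _ :=
  PiLp 2 (fun _ : S => EuclideanSpace ℝ A)

/-- The shrunk simplex `Δ_ϱ` over the actions; `ϱ = 0` is the full simplex. -/
def shrunkSimplex (A : Type*) [Fintype A] (ϱ : ℝ) : Set (EuclideanSpace ℝ A) :=
  {q | (∀ a, ϱ ≤ q a) ∧ ∑ a, q a = 1}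

/-- Policies all of whose action distributions lie in `Δ_ϱ`. -/
def shrunkPolicies (S A : Type*) [Fintype S] [Fintype A] (ϱ : ℝ) : Set (Table S A) :=
  {π | ∀ s, π s ∈ shrunkSimplex A ϱ}

/-- The Kullback-Leibler divergence `D_KL(q | r)` of two distributions on `A`
(used for `r` with full support). -/
def klDist {A : Type*} [Fintype A] (q r : EuclideanSpace ℝ A) : ℝ :=
  ∑ a, q a * Real.log (q a / r a)

/-- `E_{s ∼ ν}[D_KL(π(·|s) | φ(·|s))]`. -/
def expectedKL {S A : Type*} [Fintype S] [Fintype A] (ν : S → ℝ) (π φ : Table S A) : ℝ :=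
  ∑ s, ν s * klDist (π s) (φ s)

/-- A finite constrained MDP with `p` constraints. `cost 0` is the reward function, and
`cost i.succ` the cost function of the constraint with index `i` and limit `limit i`. -/
structure CMDP (S A : Type*) [Fintype S] [Fintype A] (p : ℕ) where
  init : S → ℝ
  init_nonneg : ∀ s, 0 ≤ init s
  init_sum : ∑ s, init s = 1
  trans : S → A → S → ℝ
  trans_nonneg : ∀ s a s', 0 ≤ trans s a s'
  trans_sum : ∀ s a, ∑ s', trans s a s' = 1
  cost : Fin (p + 1) → S → A → ℝ
  cost_nonneg : ∀ i s a, 0 ≤ cost i s a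
  cost_le_one : ∀ i s a, cost i s a ≤ 1
  limit : Fin p → ℝ

namespace CMDP

variable {S A : Type*} [Fintype S] [Fintype A] {p : ℕ}

open Classical in
/-- The probability that the state at time `m` is `s`, under the policy `π` started at `s₀`. -/
def stateProb (C : CMDP S A p) (π : Table S A) (s₀ : S) : ℕ → S → ℝ
  | 0 => fun s => if s = s₀ then 1 else 0
  | m + 1 => fun s' => ∑ s, ∑ a, stateProb C π s₀ m s * π s a * C.trans s a s'

/-- The state-value function `V^i_π(s₀) = E[∑ₘ γ^m c_i(sₘ, aₘ) | s₀, π]`. -/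
def stateValue (C : CMDP S A p) (γ : ℝ) (π : Table S A) (i : Fin (p + 1)) (s₀ : S) : ℝ :=
  ∑' m : ℕ, γ ^ m * ∑ s, ∑ a, C.stateProb π s₀ m s * π s a * C.cost i s a

/-- The action-value function: the expected discounted total of `c_i` when `s₀ = s`, `a₀ = a`
and the policy `π` is followed afterwards. -/
def actionValue (C : CMDP S A p) (γ : ℝ) (π : Table S A) (i : Fin (p + 1)) (s : S) (a : A) : ℝ :=
  C.cost i s a + γ * ∑ s', C.trans s a s' * C.stateValue γ π i s'

/-- The expected total reward (`i = 0`) or cost `J_i(π)`. -/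
def totalValue (C : CMDP S A p) (γ : ℝ) (π : Table S A) (i : Fin (p + 1)) : ℝ :=
  ∑ s, C.init s * C.stateValue γ π i s

/-- The discounted state visitation distribution of `π`, for the initial distribution of the
task. -/
def visitation (C : CMDP S A p) (γ : ℝ) (π : Table S A) (s : S) : ℝ :=
  ∑ s₀, C.init s₀ * ((1 - γ) * ∑' m : ℕ, γ ^ m * C.stateProb π s₀ m s)

/-- `π` is a policy satisfying all the constraints. -/
def IsFeasible (C : CMDP S A p) (γ : ℝ) (π : Table S A) : Prop :=
  π ∈ shrunkPolicies S A 0 ∧ ∀ i : Fin p, C.totalValue γ π i.succ ≤ C.limit i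

/-- `π` is an optimal policy of the constrained problem. -/
def IsOptimal (C : CMDP S A p) (γ : ℝ) (π : Table S A) : Prop :=
  C.IsFeasible γ π ∧ ∀ π', C.IsFeasible γ π' → C.totalValue γ π' 0 ≤ C.totalValue γ π 0

end CMDP

section CRPO

variable {S A : Type*} [Fintype S] [Fintype A] {p : ℕ}

/-- The softmax policy with parameter `θ`. -/
def softmax (θ : S → A → ℝ) : Table S A :=
  WithLp.toLp 2 fun s => WithLp.toLp 2 fun a => Real.exp (θ s a) / ∑ a', Real.exp (θ s a')

/-- All constraints hold at `π` up to the tolerance `η`. -/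
def WithinTolerance (C : CMDP S A p) (γ η : ℝ) (π : Table S A) : Prop :=
  ∀ i : Fin p, C.totalValue γ π i.succ ≤ C.limit i + η

/-- `θ 0, …, θ M` are the softmax parameters produced by `M` steps of CRPO with exact critic,
learning rate `α` and tolerance `η`. In the softmax parametrization the natural policy gradient
of `J_i` is `Q^i / (1 - γ)`, up to directions that do not change the policy. A violated constraint
to be decreased may be chosen arbitrarily. -/
structure IsCRPO (C : CMDP S A p) (γ α η : ℝ) (M : ℕ) (θ : ℕ → S → A → ℝ) : Prop where
  reward_step : ∀ m < M, WithinTolerance C γ η (softmax (θ m)) → ∀ s a,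
    θ (m + 1) s a = θ m s a + α * (C.actionValue γ (softmax (θ m)) 0 s a / (1 - γ))
  constraint_step : ∀ m < M, ¬ WithinTolerance C γ η (softmax (θ m)) →
    ∃ i : Fin p, C.limit i + η < C.totalValue γ (softmax (θ m)) i.succ ∧ ∀ s a,
      θ (m + 1) s a = θ m s a - α * (C.actionValue γ (softmax (θ m)) i.succ s a / (1 - γ))

open Classical in
/-- The set of steps at which CRPO improves the reward; the output policy is drawn uniformly
from the iterates at these steps. -/
def rewardSteps (C : CMDP S A p) (γ η : ℝ) (M : ℕ) (θ : ℕ → S → A → ℝ) : Finset ℕ :=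
  (Finset.range M).filter fun m => WithinTolerance C γ η (softmax (θ m))

/-- `E[J_i(π̂)]`, for the output `π̂` of CRPO drawn uniformly from the iterates at reward steps. -/
def expectedOutputValue (C : CMDP S A p) (γ η : ℝ) (M : ℕ) (θ : ℕ → S → A → ℝ)
    (i : Fin (p + 1)) : ℝ :=
  (∑ m ∈ rewardSteps C γ η M θ, C.totalValue γ (softmax (θ m)) i) /
    ((rewardSteps C γ η M θ).card : ℝ)

end CRPO

section Meta

variable {S A : Type*} [Fintype S] [Fintype A] {p : ℕ}

/-- `x` is a Euclidean projection of `y` onto `X`. -/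
def IsProjection {E : Type*} [NormedAddCommGroup E] (X : Set E) (y x : E) : Prop :=
  x ∈ X ∧ ∀ z ∈ X, ‖y - x‖ ≤ ‖y - z‖

/-- The tolerance of CRPO in a task, `lam ⬝ (D + 2 M α² κ) / (α M)`, where `D` is the expected
divergence of the optimal policy from the initial one. -/
def tolerance (C : CMDP S A p) (γ α κ lam : ℝ) (M : ℕ) (πstar φ : Table S A) : ℝ :=
  lam / (α * M) * (expectedKL (C.visitation γ πstar) πstar φ + 2 * M * α ^ 2 * κ)

/-- One realization of the two-level algorithm over the tasks `0, …, T - 1`: CRPO with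
learning rate `α` and tolerances `η t` is started at `φ t` and follows the parameters `θ t`;
`πhat t` is its output; `νhat t` is an estimated state distribution; and `φ` is obtained by
projected online gradient descent with step size `β`, from the projection of `0`, on the losses
`E_{νhat t}[D_KL(πhat t | ·)]`. -/
structure IsMetaRun {T : ℕ} (tasks : Fin T → CMDP S A p) (γ ϱ α β : ℝ) (η : Fin T → ℝ) (M : ℕ)
    (φ : ℕ → Table S A) (θ : Fin T → ℕ → S → A → ℝ) (πhat : Fin T → Table S A)
    (νhat : Fin T → S → ℝ) : Prop where
  first : IsProjection (shrunkPolicies S A ϱ) 0 (φ 0)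
  start : ∀ t : Fin T, softmax (θ t 0) = φ t
  within_task : ∀ t : Fin T, IsCRPO (tasks t) γ α (η t) M (θ t)
  output_policy : ∀ t : Fin T, πhat t ∈ shrunkPolicies S A 0
  output : ∀ t : Fin T, (rewardSteps (tasks t) γ (η t) M (θ t)).Nonempty →
    ∃ m ∈ rewardSteps (tasks t) γ (η t) M (θ t), πhat t = softmax (θ t m)
  estimate_nonneg : ∀ t s, 0 ≤ νhat t s
  estimate_sum : ∀ t, ∑ s, νhat t s = 1
  update : ∀ t : Fin T, IsProjection (shrunkPolicies S A ϱ)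
    (φ t - β • gradient (expectedKL (νhat t) (πhat t)) (φ t)) (φ (t + 1))

/-- The average estimated loss of a fixed initial policy `φ`. -/
def averageLoss {T : ℕ} (νhat : Fin T → S → ℝ) (πhat : Fin T → Table S A) (φ : Table S A) : ℝ :=
  (1 / (T : ℝ)) * ∑ t, expectedKL (νhat t) (πhat t) φ

/-- The squared empirical task-similarity: the least average estimated loss of a fixed initial
policy in `Δ_ϱ^S`. -/
def empiricalSimilaritySq {T : ℕ} (ϱ : ℝ) (νhat : Fin T → S → ℝ) (πhat : Fin T → Table S A) : ℝ :=
  sInf (averageLoss νhat πhat '' shrunkPolicies S A ϱ)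

/-- `D_KL(q | ·)` is `Lg`-Lipschitz and `Lpi`-smooth on `Δ_ϱ`. -/
def KLRegular {A : Type*} [Fintype A] (ϱ Lg Lpi : ℝ) (q : EuclideanSpace ℝ A) : Prop :=
  ∀ r ∈ shrunkSimplex A ϱ, ∀ r' ∈ shrunkSimplex A ϱ,
    |klDist q r - klDist q r'| ≤ Lg * ‖r - r'‖ ∧
    ‖gradient (klDist q) r - gradient (klDist q) r'‖ ≤ Lpi * ‖r - r'‖

/-- The constant `max (|S||A| / (1 - γ)³) (1 / (16 (1 - γ)⁴))`; the first entry is the larger one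
if and only if `1 / (1 - γ) ≤ 16 |S||A|`. -/
def stepConstant (S A : Type*) [Fintype S] [Fintype A] (γ : ℝ) : ℝ :=
  max ((Fintype.card S : ℝ) * Fintype.card A / (1 - γ) ^ 3) (1 / (16 * (1 - γ) ^ 4))

/-- The quantity `c₁ / √T + c₂ E_T / T + D̂²` under the root, with `c₁ = √2 Lg b`,
`c₂ = 2 + 4 √2 Lg Lpi b / ((2 C₁ - C₁² Lpi) √T)`, where `b` is the norm of the comparator. -/
def rateBound (T : ℕ) (Lg Lpi C₁ b ET Dsq : ℝ) : ℝ :=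
  √2 * Lg * b / √(T : ℝ) +
    (2 + 4 * √2 * Lg * Lpi * b / ((2 * C₁ - C₁ ^ 2 * Lpi) * √(T : ℝ))) * (ET / T) + Dsq

end Meta

end MetaSRL

end

/-!
The argument combines a potential argument inside each task with online convex optimization across
tasks.

Inside a task, let `D` be the divergence of the optimal policy `π⋆` from the current iterate, averaged
over the state visitation of `π⋆`. By the performance difference lemma
(`CMDP.totalValue_sub_totalValue`) and Hoeffding's lemma for the normalizing constants of the softmax
(`sum_sub_mul_le_klDist_sub_klDist`), a step of CRPO on `J_i` decreases `D` by at least the step size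
times the gap between the `i`-th values of `π⋆` and of the iterate, up to `2 α² κ` (`policy_step`);
here Hoeffding's lemma gives exactly the second entry `1 / (16 (1 - γ)⁴)` of `κ`. A constraint step has
gap more than the tolerance `η`, since `π⋆` is feasible. As `D ≥ 0` throughout, a tolerance with
`α M η ≥ D₀ + 2 M α² κ` rules out `M` constraint steps and bounds the average optimality gap at the
reward steps by `η`; the constraint violations there are at most `η` by definition
(`IsCRPO.guarantee`).

Across tasks, it remains to bound the average of `D₀`, the loss `f_t(φ_t)`, by `B`. It is within `ε_t`
of the estimated loss, whose exact gradients drive the projected gradient descent, so the standard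
regret bound applies (`IsMetaRun.regret_le`). The full gradient of the divergence
need not be bounded by the Lipschitz constant on the simplex, because its normal component is
uncontrolled; only the derivative along the feasible direction from `φ_t` to `φ_{t+1}` enters, and
this one is bounded (`projected_gradient_step`).
-/

namespace MetaSRL

/-! ### Values and visitation distributions of a finite Markov decision process -/

/-- A geometrically discounted sum of a bounded sequence converges. -/
lemma summable_pow_mul_of_abs_le {γ : ℝ} (hγ0 : 0 ≤ γ) (hγ1 : γ < 1) {f : ℕ → ℝ} {c : ℝ}
    (hf : ∀ m, |f m| ≤ c) : Summable fun m => γ ^ m * f m := by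
  refine Summable.of_norm_bounded ((summable_geometric_of_lt_one hγ0 hγ1).mul_right c) fun m => ?_
  rw [Real.norm_eq_abs, abs_mul, abs_of_nonneg (pow_nonneg hγ0 m)]
  exact mul_le_mul_of_nonneg_left (hf m) (pow_nonneg hγ0 m)

/-- A discounted sum of a sequence in `[0, 1]` lies in `[0, 1 / (1 - γ)]`. -/
lemma tsum_pow_mul_mem_Icc {γ : ℝ} (hγ0 : 0 ≤ γ) (hγ1 : γ < 1) {f : ℕ → ℝ}
    (hf : ∀ m, f m ∈ Set.Icc (0 : ℝ) 1) :
    ∑' m, γ ^ m * f m ∈ Set.Icc 0 (1 / (1 - γ)) := by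
  refine ⟨tsum_nonneg fun m => mul_nonneg (pow_nonneg hγ0 m) (hf m).1, ?_⟩
  rw [one_div, ← tsum_geometric_of_lt_one hγ0 hγ1]
  refine Summable.tsum_le_tsum (fun m => mul_le_of_le_one_right (pow_nonneg hγ0 m) (hf m).2)
    (summable_pow_mul_of_abs_le hγ0 hγ1 (c := 1) fun m => ?_) (summable_geometric_of_lt_one hγ0 hγ1)
  rw [abs_of_nonneg (hf m).1]
  exact (hf m).2

lemma sum_mul_mem_Icc {ι : Type*} [Fintype ι] {w f : ι → ℝ} (hw : ∀ i, 0 ≤ w i)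
    (hw1 : ∑ i, w i = 1) {c : ℝ} (hf : ∀ i, f i ∈ Set.Icc 0 c) :
    ∑ i, w i * f i ∈ Set.Icc 0 c := by
  refine ⟨Finset.sum_nonneg fun i _ => mul_nonneg (hw i) (hf i).1, ?_⟩
  calc ∑ i, w i * f i ≤ ∑ i, w i * c :=
        Finset.sum_le_sum fun i _ => mul_le_mul_of_nonneg_left (hf i).2 (hw i)
    _ = c := by rw [← Finset.sum_mul, hw1, one_mul]

namespace CMDP

variable {S A : Type*} [Fintype S] [Fintype A] {p : ℕ}

lemma stateProb_nonneg (C : CMDP S A p) {π : Table S A} (hπ : π ∈ shrunkPolicies S A 0)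
    (s₀ : S) (m : ℕ) (s : S) : 0 ≤ C.stateProb π s₀ m s := by
  induction m generalizing s with
  | zero => unfold stateProb; split_ifs <;> norm_num
  | succ m ih =>
    exact Finset.sum_nonneg fun s' _ => Finset.sum_nonneg fun a _ =>
      mul_nonneg (mul_nonneg (ih s') ((hπ s').1 a)) (C.trans_nonneg _ _ _)

lemma sum_stateProb_succ_mul (C : CMDP S A p) (π : Table S A) (s₀ : S) (m : ℕ) (f : S → ℝ) :
    ∑ s', C.stateProb π s₀ (m + 1) s' * f s' =
      ∑ s, C.stateProb π s₀ m s * ∑ a, π s a * ∑ s', C.trans s a s' * f s' := by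
  simp only [stateProb, Finset.sum_mul, Finset.mul_sum]
  rw [Finset.sum_comm]
  refine Finset.sum_congr rfl fun s _ => ?_
  rw [Finset.sum_comm]
  refine Finset.sum_congr rfl fun a _ => Finset.sum_congr rfl fun s' _ => ?_
  ring

lemma sum_stateProb_zero_mul (C : CMDP S A p) (π : Table S A) (s₀ : S) (f : S → ℝ) :
    ∑ s, C.stateProb π s₀ 0 s * f s = f s₀ := by
  classical
  simp [stateProb]

lemma sum_stateProb (C : CMDP S A p) {π : Table S A} (hπ : π ∈ shrunkPolicies S A 0)
    (s₀ : S) (m : ℕ) : ∑ s, C.stateProb π s₀ m s = 1 := by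
  induction m with
  | zero => simpa using C.sum_stateProb_zero_mul π s₀ fun _ => 1
  | succ m ih =>
    have h := C.sum_stateProb_succ_mul π s₀ m fun _ => 1
    simpa [C.trans_sum, (hπ _).2, ih] using h

lemma stateProb_le_one (C : CMDP S A p) {π : Table S A} (hπ : π ∈ shrunkPolicies S A 0)
    (s₀ : S) (m : ℕ) (s : S) : C.stateProb π s₀ m s ≤ 1 := by
  rw [← C.sum_stateProb hπ s₀ m]
  exact Finset.single_le_sum (fun s _ => C.stateProb_nonneg hπ s₀ m s) (Finset.mem_univ s)

/-- Decomposition by the first transition; the definition of `stateProb` is by the last one. -/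
lemma stateProb_succ' (C : CMDP S A p) (π : Table S A) (s₀ : S) (m : ℕ) (s : S) :
    C.stateProb π s₀ (m + 1) s =
      ∑ a, π s₀ a * ∑ s', C.trans s₀ a s' * C.stateProb π s' m s := by
  classical
  induction m generalizing s with
  | zero => simp [stateProb, ite_mul]
  | succ m ih =>
    rw [stateProb]
    simp only [ih]
    conv_rhs => simp only [stateProb]
    simp only [Finset.sum_mul, Finset.mul_sum]
    calc _ = ∑ x, ∑ b, ∑ y, ∑ z, π s₀ b * C.trans s₀ b z * C.stateProb π z m x * π x y
              * C.trans x y s := by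
            refine Finset.sum_congr rfl fun x _ => ?_
            rw [Finset.sum_comm]
            simp only [mul_assoc]
      _ = ∑ b, ∑ x, ∑ y, ∑ z, π s₀ b * C.trans s₀ b z * C.stateProb π z m x * π x y
              * C.trans x y s := Finset.sum_comm
      _ = _ := by
            refine Finset.sum_congr rfl fun b _ => ?_
            have e : ∀ F : S → A → S → ℝ, ∑ x, ∑ y, ∑ z, F x y z = ∑ z, ∑ x, ∑ y, F x y z := by
              intro F
              rw [Finset.sum_comm (f := fun z x => ∑ y, F x y z)]
              exact Finset.sum_congr rfl fun x _ => Finset.sum_comm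
            rw [e]
            simp only [mul_assoc]

section Discounted

variable {γ : ℝ}

/-- The expected cost `c_i` at time `m`. -/
noncomputable def stageCost (C : CMDP S A p) (π : Table S A) (i : Fin (p + 1)) (s₀ : S) (m : ℕ) : ℝ :=
  ∑ s, C.stateProb π s₀ m s * ∑ a, π s a * C.cost i s a

lemma stateValue_eq (C : CMDP S A p) (π : Table S A) (i : Fin (p + 1)) (s₀ : S) :
    C.stateValue γ π i s₀ = ∑' m, γ ^ m * C.stageCost π i s₀ m := by
  simp only [stateValue, stageCost, Finset.mul_sum, mul_assoc]

lemma stageCost_mem_Icc (C : CMDP S A p) {π : Table S A} (hπ : π ∈ shrunkPolicies S A 0)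
    (i : Fin (p + 1)) (s₀ : S) (m : ℕ) : C.stageCost π i s₀ m ∈ Set.Icc (0 : ℝ) 1 :=
  sum_mul_mem_Icc (C.stateProb_nonneg hπ s₀ m) (C.sum_stateProb hπ s₀ m) fun s =>
    sum_mul_mem_Icc (hπ s).1 (hπ s).2 fun a => ⟨C.cost_nonneg i s a, C.cost_le_one i s a⟩

lemma summable_stageCost (C : CMDP S A p) (hγ0 : 0 ≤ γ) (hγ1 : γ < 1) {π : Table S A}
    (hπ : π ∈ shrunkPolicies S A 0) (i : Fin (p + 1)) (s₀ : S) :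
    Summable fun m => γ ^ m * C.stageCost π i s₀ m :=
  summable_pow_mul_of_abs_le hγ0 hγ1 (c := 1) fun m => by
    have h := C.stageCost_mem_Icc hπ i s₀ m
    rw [abs_of_nonneg h.1]
    exact h.2

lemma stateValue_mem_Icc (C : CMDP S A p) (hγ0 : 0 ≤ γ) (hγ1 : γ < 1) {π : Table S A}
    (hπ : π ∈ shrunkPolicies S A 0) (i : Fin (p + 1)) (s₀ : S) :
    C.stateValue γ π i s₀ ∈ Set.Icc 0 (1 / (1 - γ)) := by
  rw [stateValue_eq]
  exact tsum_pow_mul_mem_Icc hγ0 hγ1 (C.stageCost_mem_Icc hπ i s₀)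

lemma actionValue_mem_Icc (C : CMDP S A p) (hγ0 : 0 ≤ γ) (hγ1 : γ < 1) {π : Table S A}
    (hπ : π ∈ shrunkPolicies S A 0) (i : Fin (p + 1)) (s : S) (a : A) :
    C.actionValue γ π i s a ∈ Set.Icc 0 (1 / (1 - γ)) := by
  have h := sum_mul_mem_Icc (C.trans_nonneg s a) (C.trans_sum s a)
    (C.stateValue_mem_Icc hγ0 hγ1 hπ i)
  have h0 := C.cost_nonneg i s a
  have h1 := C.cost_le_one i s a
  have hpos : 0 < 1 - γ := sub_pos.2 hγ1
  refine ⟨add_nonneg h0 (mul_nonneg hγ0 h.1), ?_⟩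
  have e : 1 / (1 - γ) = 1 + γ * (1 / (1 - γ)) := by field_simp; ring
  rw [e]
  exact add_le_add h1 (mul_le_mul_of_nonneg_left h.2 hγ0)

lemma stageCost_succ (C : CMDP S A p) (π : Table S A) (i : Fin (p + 1)) (s₀ : S) (m : ℕ) :
    C.stageCost π i s₀ (m + 1) =
      ∑ a, π s₀ a * ∑ s', C.trans s₀ a s' * C.stageCost π i s' m := by
  simp only [stageCost, stateProb_succ', Finset.mul_sum (Finset.univ : Finset S), Finset.sum_mul]
  rw [Finset.sum_comm]
  refine Finset.sum_congr rfl fun a _ => ?_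
  rw [Finset.sum_comm]
  refine Finset.sum_congr rfl fun s' _ => Finset.sum_congr rfl fun s _ => ?_
  ring

/-- The Bellman equation. -/
lemma stateValue_eq_sum_actionValue (C : CMDP S A p) (hγ0 : 0 ≤ γ) (hγ1 : γ < 1) {π : Table S A}
    (hπ : π ∈ shrunkPolicies S A 0) (i : Fin (p + 1)) (s₀ : S) :
    C.stateValue γ π i s₀ = ∑ a, π s₀ a * C.actionValue γ π i s₀ a := by
  rw [stateValue_eq, (C.summable_stageCost hγ0 hγ1 hπ i s₀).tsum_eq_zero_add]
  have h1 : ∑' m, γ ^ (m + 1) * C.stageCost π i s₀ (m + 1) =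
      ∑ a, π s₀ a * (γ * ∑ s', C.trans s₀ a s' * C.stateValue γ π i s') := by
    have hs : ∀ s', HasSum (fun m => γ ^ m * C.stageCost π i s' m) (C.stateValue γ π i s') := by
      intro s'
      rw [stateValue_eq]
      exact (C.summable_stageCost hγ0 hγ1 hπ i s').hasSum
    have := hasSum_sum fun a (_ : a ∈ Finset.univ) => ((hasSum_sum fun s' (_ : s' ∈ Finset.univ) =>
      (hs s').mul_left (C.trans s₀ a s')).mul_left γ).mul_left (π s₀ a)
    rw [← this.tsum_eq]
    congr 1
    ext m
    rw [stageCost_succ, Finset.mul_sum]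
    refine Finset.sum_congr rfl fun a _ => ?_
    simp only [Finset.mul_sum]
    refine Finset.sum_congr rfl fun s' _ => ?_
    ring
  rw [h1]
  simp only [stageCost, sum_stateProb_zero_mul, actionValue, mul_add, Finset.sum_add_distrib,
    pow_zero, one_mul]

lemma visitation_nonneg (C : CMDP S A p) (hγ0 : 0 ≤ γ) (hγ1 : γ < 1) {π : Table S A}
    (hπ : π ∈ shrunkPolicies S A 0) (s : S) : 0 ≤ C.visitation γ π s :=
  Finset.sum_nonneg fun s₀ _ => mul_nonneg (C.init_nonneg s₀) <|
    mul_nonneg (sub_nonneg.2 hγ1.le) <| tsum_nonneg fun m =>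
      mul_nonneg (pow_nonneg hγ0 m) (C.stateProb_nonneg hπ s₀ m s)

/-- An expectation under the visitation distribution is a normalized discounted sum of
expectations. -/
lemma sum_visitation_mul (C : CMDP S A p) (hγ0 : 0 ≤ γ) (hγ1 : γ < 1) {π : Table S A}
    (hπ : π ∈ shrunkPolicies S A 0) (f : S → ℝ) :
    ∑ s, C.visitation γ π s * f s =
      (1 - γ) * ∑ s₀, C.init s₀ * ∑' m, γ ^ m * ∑ s, C.stateProb π s₀ m s * f s := by
  have hs : ∀ s₀ s, Summable fun m => γ ^ m * C.stateProb π s₀ m s := fun s₀ s =>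
    summable_pow_mul_of_abs_le hγ0 hγ1 (c := 1) fun m => by
      rw [abs_of_nonneg (C.stateProb_nonneg hπ s₀ m s)]
      exact C.stateProb_le_one hπ s₀ m s
  have h : ∀ s₀, ∑' m, γ ^ m * ∑ s, C.stateProb π s₀ m s * f s =
      ∑ s, (∑' m, γ ^ m * C.stateProb π s₀ m s) * f s := by
    intro s₀
    rw [← (hasSum_sum fun s (_ : s ∈ Finset.univ) => (hs s₀ s).hasSum.mul_right (f s)).tsum_eq]
    simp only [Finset.mul_sum, mul_assoc]
  simp only [h, visitation]
  simp only [Finset.mul_sum (Finset.univ : Finset S), Finset.sum_mul]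
  rw [Finset.sum_comm]
  refine Finset.sum_congr rfl fun s₀ _ => Finset.sum_congr rfl fun s _ => ?_
  ring

/-- The performance difference lemma: the gap between the values of two policies is the expected
advantage of the second one under the state visitation and the actions of the first one. -/
lemma totalValue_sub_totalValue (C : CMDP S A p) (hγ0 : 0 ≤ γ) (hγ1 : γ < 1) {π π' : Table S A}
    (hπ : π ∈ shrunkPolicies S A 0) (hπ' : π' ∈ shrunkPolicies S A 0) (i : Fin (p + 1)) :
    ∑ s, C.visitation γ π s * ∑ a, (π s a - π' s a) * C.actionValue γ π' i s a =
      (1 - γ) * (C.totalValue γ π i - C.totalValue γ π' i) := by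
  rw [sum_visitation_mul C hγ0 hγ1 hπ, totalValue, totalValue, ← Finset.sum_sub_distrib]
  congr 1
  refine Finset.sum_congr rfl fun s₀ _ => ?_
  rw [← mul_sub]
  congr 1
  set V := C.stateValue γ π' i
  set v : ℕ → ℝ := fun m => ∑ s, C.stateProb π s₀ m s * V s with hv
  have hvs : Summable fun m => γ ^ m * v m :=
    summable_pow_mul_of_abs_le hγ0 hγ1 (c := 1 / (1 - γ)) fun m => by
      have h := sum_mul_mem_Icc (C.stateProb_nonneg hπ s₀ m) (C.sum_stateProb hπ s₀ m)
        (C.stateValue_mem_Icc hγ0 hγ1 hπ' i)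
      rw [abs_of_nonneg h.1]
      exact h.2
  -- The values of the second policy telescope along the trajectory of the first one.
  have key : ∀ m, γ ^ m * ∑ s, C.stateProb π s₀ m s *
      ∑ a, (π s a - π' s a) * C.actionValue γ π' i s a =
      γ ^ m * C.stageCost π i s₀ m + (γ ^ (m + 1) * v (m + 1) - γ ^ m * v m) := by
    intro m
    have e : ∀ s, ∑ a, (π s a - π' s a) * C.actionValue γ π' i s a =
        ∑ a, π s a * C.cost i s a + γ * ∑ a, π s a * ∑ s', C.trans s a s' * V s' - V s := by
      intro s
      simp only [sub_mul, Finset.sum_sub_distrib]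
      rw [← C.stateValue_eq_sum_actionValue hγ0 hγ1 hπ' i s]
      simp only [actionValue, mul_add, Finset.sum_add_distrib]
      rw [Finset.mul_sum]
      congr 2
      exact Finset.sum_congr rfl fun a _ => by ring
    have e2 : v (m + 1) = _ := C.sum_stateProb_succ_mul π s₀ m V
    rw [e2]
    simp only [e, mul_sub, mul_add, Finset.sum_sub_distrib, Finset.sum_add_distrib, stageCost, hv]
    have e3 : ∀ x : S → ℝ, ∑ s, C.stateProb π s₀ m s * (γ * x s) =
        γ * ∑ s, C.stateProb π s₀ m s * x s := fun x => by
      rw [Finset.mul_sum]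
      exact Finset.sum_congr rfl fun s _ => by ring
    rw [e3]
    ring
  simp only [key]
  have hvs' : Summable fun m => γ ^ (m + 1) * v (m + 1) := (summable_nat_add_iff 1).2 hvs
  rw [(C.summable_stageCost hγ0 hγ1 hπ i s₀).tsum_add (hvs'.sub hvs), hvs'.tsum_sub hvs,
    hvs.tsum_eq_zero_add, ← stateValue_eq]
  have h0 : v 0 = V s₀ := C.sum_stateProb_zero_mul π s₀ V
  rw [h0]
  ring

lemma sum_visitation (C : CMDP S A p) (hγ0 : 0 ≤ γ) (hγ1 : γ < 1) {π : Table S A}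
    (hπ : π ∈ shrunkPolicies S A 0) : ∑ s, C.visitation γ π s = 1 := by
  have h := C.sum_visitation_mul hγ0 hγ1 hπ fun _ => 1
  have hpos : 1 - γ ≠ 0 := (sub_pos.2 hγ1).ne'
  simpa [C.sum_stateProb hπ, tsum_geometric_of_lt_one hγ0 hγ1, ← Finset.sum_mul, C.init_sum,
    hpos] using h

end Discounted

end CMDP

/-! ### The Kullback-Leibler divergence and softmax updates -/

section KL

variable {A : Type*} [Fintype A]

/-- Hoeffding's lemma for a finite distribution, in logarithmic form. -/
lemma log_sum_mul_exp_le {w x : A → ℝ} (hw : ∀ a, 0 ≤ w a) (hw1 : ∑ a, w a = 1) {l u : ℝ}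
    (hx : ∀ a, x a ∈ Set.Icc l u) :
    Real.log (∑ a, w a * Real.exp (x a)) ≤ ∑ a, w a * x a + (u - l) ^ 2 / 8 := by
  let : MeasurableSpace A := ⊤
  have h1 : ∑ a, ENNReal.ofReal (w a) = 1 := by
    rw [← ENNReal.ofReal_sum_of_nonneg fun a _ => hw a, hw1, ENNReal.ofReal_one]
  set P : PMF A := PMF.ofFintype (fun a => ENNReal.ofReal (w a)) h1 with hP
  have hint : ∀ f : A → ℝ, ∫ a, f a ∂P.toMeasure = ∑ a, w a * f a := fun f => by
    simp [PMF.integral_eq_sum, hP, ENNReal.toReal_ofReal (hw _)]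
  have h := (ProbabilityTheory.hasSubgaussianMGF_of_mem_Icc (μ := P.toMeasure) (X := x)
    (measurable_of_finite x).aemeasurable (Filter.Eventually.of_forall hx)).mgf_le 1
  simp only [ProbabilityTheory.mgf, hint, one_mul] at h
  obtain ⟨a₀, -, ha₀⟩ : ∃ a ∈ Finset.univ, w a ≠ 0 :=
    Finset.exists_ne_zero_of_sum_ne_zero (by rw [hw1]; norm_num)
  have hpos : 0 < ∑ a, w a * Real.exp (x a) :=
    Finset.sum_pos' (fun a _ => mul_nonneg (hw a) (Real.exp_pos _).le)
      ⟨a₀, Finset.mem_univ _, mul_pos ((hw a₀).lt_of_ne' ha₀) (Real.exp_pos _)⟩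
  have e : ∑ a, w a * Real.exp (x a - ∑ a, w a * x a) =
      (∑ a, w a * Real.exp (x a)) / Real.exp (∑ a, w a * x a) := by
    rw [Finset.sum_div]
    exact Finset.sum_congr rfl fun a _ => by rw [Real.exp_sub]; ring
  rw [e, div_le_iff₀ (Real.exp_pos _), ← Real.exp_add] at h
  refine (Real.log_le_iff_le_exp hpos).2 (h.trans (Real.exp_le_exp.2 (le_of_eq ?_)))
  push_cast
  rw [div_pow, Real.norm_eq_abs, sq_abs]
  ring

/-- Gibbs' inequality. -/
lemma klDist_nonneg {q r : EuclideanSpace ℝ A} (hq : q ∈ shrunkSimplex A 0)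
    (hr : ∀ a, 0 < r a) (hr1 : ∑ a, r a = 1) : 0 ≤ klDist q r := by
  have h : ∀ a, q a - r a ≤ q a * Real.log (q a / r a) := by
    intro a
    rcases (hq.1 a).eq_or_lt with h0 | h0
    · rw [← h0]
      simpa using (hr a).le
    · have h2 := Real.one_sub_inv_le_log_of_pos (div_pos h0 (hr a))
      calc q a - r a = q a * (1 - (q a / r a)⁻¹) := by
            have := h0.ne'
            field_simp
        _ ≤ _ := mul_le_mul_of_nonneg_left h2 h0.le
  calc (0 : ℝ) = ∑ a, (q a - r a) := by rw [Finset.sum_sub_distrib, hq.2, hr1, sub_self]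
    _ ≤ _ := Finset.sum_le_sum fun a _ => h a

lemma klDist_sub_klDist {q r r' : EuclideanSpace ℝ A} (hr : ∀ a, 0 < r a) (hr' : ∀ a, 0 < r' a) :
    klDist q r - klDist q r' = ∑ a, q a * (Real.log (r' a) - Real.log (r a)) := by
  rw [klDist, klDist, ← Finset.sum_sub_distrib]
  refine Finset.sum_congr rfl fun a _ => ?_
  rcases eq_or_ne (q a) 0 with h | h
  · simp [h]
  · rw [Real.log_div h (hr a).ne', Real.log_div h (hr' a).ne']
    ring

variable {S : Type*} [Fintype S]

lemma sum_exp_pos [Nonempty A] (f : A → ℝ) : 0 < ∑ a, Real.exp (f a) :=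
  Finset.sum_pos (fun _ _ => Real.exp_pos _) Finset.univ_nonempty

lemma softmax_apply (θ : S → A → ℝ) (s : S) (a : A) :
    softmax θ s a = Real.exp (θ s a) / ∑ a', Real.exp (θ s a') := rfl

lemma softmax_pos [Nonempty A] (θ : S → A → ℝ) (s : S) (a : A) : 0 < softmax θ s a :=
  div_pos (Real.exp_pos _) (sum_exp_pos _)

lemma sum_softmax [Nonempty A] (θ : S → A → ℝ) (s : S) : ∑ a, softmax θ s a = 1 := by
  simp only [softmax_apply]
  rw [← Finset.sum_div, div_self (sum_exp_pos _).ne']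

lemma softmax_mem_shrunkPolicies [Nonempty A] (θ : S → A → ℝ) :
    softmax θ ∈ shrunkPolicies S A 0 :=
  fun s => ⟨fun a => (softmax_pos θ s a).le, sum_softmax θ s⟩

/-- The effect of an additive update of the softmax parameters on the divergence from a fixed
distribution, with the second-order term from Hoeffding's lemma. -/
lemma sum_sub_mul_le_klDist_sub_klDist [Nonempty A] {q : EuclideanSpace ℝ A}
    (hq : ∑ a, q a = 1) {θ θ' : S → A → ℝ} (s : S) {l u : ℝ}
    (hx : ∀ a, θ' s a - θ s a ∈ Set.Icc l u) :
    ∑ a, (q a - softmax θ s a) * (θ' s a - θ s a) - (u - l) ^ 2 / 8 ≤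
      klDist q (softmax θ s) - klDist q (softmax θ' s) := by
  have hlog : ∀ (θ : S → A → ℝ) a,
      Real.log (softmax θ s a) = θ s a - Real.log (∑ a', Real.exp (θ s a')) := fun θ a => by
    rw [softmax_apply, Real.log_div (Real.exp_pos _).ne' (sum_exp_pos _).ne', Real.log_exp]
  have hZ : ∑ a, softmax θ s a * Real.exp (θ' s a - θ s a) =
      (∑ a, Real.exp (θ' s a)) / ∑ a, Real.exp (θ s a) := by
    rw [Finset.sum_div]
    refine Finset.sum_congr rfl fun a _ => ?_
    rw [softmax_apply, Real.exp_sub]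
    have := (Real.exp_pos (θ s a)).ne'
    field_simp
  have h := log_sum_mul_exp_le (fun a => (softmax_pos θ s a).le) (sum_softmax θ s) hx
  rw [hZ, Real.log_div (sum_exp_pos _).ne' (sum_exp_pos _).ne'] at h
  rw [klDist_sub_klDist (softmax_pos θ s) (softmax_pos θ' s)]
  have e : ∑ a, q a * (Real.log (softmax θ' s a) - Real.log (softmax θ s a)) =
      ∑ a, q a * (θ' s a - θ s a) -
        (Real.log (∑ a, Real.exp (θ' s a)) - Real.log (∑ a, Real.exp (θ s a))) := by
    rw [← one_mul (Real.log _ - Real.log _), ← hq, Finset.sum_mul, ← Finset.sum_sub_distrib]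
    refine Finset.sum_congr rfl fun a _ => ?_
    rw [hlog, hlog]
    ring
  rw [e]
  simp only [sub_mul (q _), Finset.sum_sub_distrib]
  linarith

lemma expectedKL_nonneg {ν : S → ℝ} (hν : ∀ s, 0 ≤ ν s) {π φ : Table S A}
    (hπ : π ∈ shrunkPolicies S A 0) (hφ : ∀ s a, 0 < φ s a) (hφ1 : ∀ s, ∑ a, φ s a = 1) :
    0 ≤ expectedKL ν π φ :=
  Finset.sum_nonneg fun s _ => mul_nonneg (hν s) (klDist_nonneg (hπ s) (hφ s) (hφ1 s))

end KL

/-! ### Projections and the gradients of the estimated losses -/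

section Projection

variable {E : Type*} [NormedAddCommGroup E] [InnerProductSpace ℝ E]

/-- The variational inequality of a projection onto a convex set, as a Pythagorean inequality. -/
lemma IsProjection.norm_sub_sq_le {X : Set E} (hX : Convex ℝ X) {y x z : E}
    (h : IsProjection X y x) (hz : z ∈ X) : ‖x - z‖ ^ 2 + ‖y - x‖ ^ 2 ≤ ‖y - z‖ ^ 2 := by
  have h1 : inner ℝ (y - x) (z - x) ≤ 0 := by
    refine (norm_eq_iInf_iff_real_inner_le_zero hX h.1).1 ?_ z hz
    have : Nonempty X := ⟨⟨x, h.1⟩⟩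
    exact le_antisymm (le_ciInf fun w => h.2 w w.2)
      (ciInf_le ⟨0, by rintro _ ⟨w, rfl⟩; exact norm_nonneg _⟩ (⟨x, h.1⟩ : X))
  have h2 := norm_sub_sq_real (y - x) (z - x)
  rw [sub_sub_sub_cancel_right, norm_sub_rev z x] at h2
  linarith

/-- A bound on the increments of a function along a segment bounds its derivative at the
starting point. -/
lemma inner_gradient_le [CompleteSpace E] {f : E → ℝ} {x v : E} {c : ℝ}
    (hf : DifferentiableAt ℝ f x)
    (h : ∀ r ∈ Set.Ioo (0 : ℝ) 1, f (x + r • v) - f x ≤ r * c) :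
    inner ℝ (gradient f x) v ≤ c := by
  have h1 : HasDerivAt (fun r : ℝ => f (x + r • v)) (inner ℝ (gradient f x) v) 0 := by
    rw [inner_gradient_left]
    have h2 : HasFDerivAt f (fderiv ℝ f x) (x + (0 : ℝ) • v) := by simpa using hf.hasFDerivAt
    have h3 : HasDerivAt (fun r : ℝ => x + r • v) v 0 := by
      simpa using ((hasDerivAt_id (0 : ℝ)).smul_const v).const_add x
    exact h2.comp_hasDerivAt 0 h3
  have h4 := h1.tendsto_slope_zero_right
  refine le_of_tendsto h4 ?_
  filter_upwards [Ioo_mem_nhdsGT (zero_lt_one (α := ℝ))] with r hr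
  have := h r hr
  simp only [zero_add, zero_smul, add_zero, smul_eq_mul]
  rw [inv_mul_le_iff₀ hr.1]
  exact this

/-- One step of projected gradient descent on a convex loss, compared with a point `z`, when
the loss falls from `x` to any point of `X` by at most `L` times their distance. Only the derivative of
the loss in the direction of the next iterate matters, so the full gradient need not be bounded
by `L`. -/
lemma projected_gradient_step [CompleteSpace E] {X : Set E} (hX : Convex ℝ X) {f : E → ℝ}
    {x x' z : E} {β L : ℝ} (hβ : 0 ≤ β) (hx : x ∈ X) (hz : z ∈ X) (hf : DifferentiableAt ℝ f x)
    (hLip : ∀ y ∈ X, f x - f y ≤ L * ‖x - y‖) (hconv : ConvexOn ℝ X f)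
    (h : IsProjection X (x - β • gradient f x) x') :
    2 * β * (f x - f z) ≤ ‖x - z‖ ^ 2 - ‖x' - z‖ ^ 2 + β ^ 2 * L ^ 2 := by
  set g := gradient f x
  have h1 := h.norm_sub_sq_le hX hz
  have hg1 : inner ℝ g (z - x) ≤ f z - f x := by
    refine inner_gradient_le hf fun r hr => ?_
    have h2 := hconv.2 hx hz (sub_nonneg.2 hr.2.le) hr.1.le (by ring)
    have e : (1 - r) • x + r • z = x + r • (z - x) := by module
    rw [e, smul_eq_mul, smul_eq_mul] at h2
    linarith
  -- Along the segment from `x` to `x'`, which stays in `X`, the loss decreases at rate at most `L`.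
  have hg2 : inner ℝ g (x - x') ≤ L * ‖x - x'‖ := by
    have hd : DifferentiableAt ℝ (fun y => -f y) x := hf.neg
    have e1 : inner ℝ (gradient (fun y => -f y) x) (x' - x) = inner ℝ g (x - x') := by
      rw [inner_gradient_left, inner_gradient_left, fderiv_fun_neg, ← neg_sub x x']
      simp
    rw [← e1]
    refine inner_gradient_le hd fun r hr => ?_
    have hmem : x + r • (x' - x) ∈ X := by
      have := hX hx h.1 (sub_nonneg.2 hr.2.le) hr.1.le (by ring)
      have e : (1 - r) • x + r • x' = x + r • (x' - x) := by module
      rwa [e] at this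
    have h3 := hLip _ hmem
    rw [show x - (x + r • (x' - x)) = r • (x - x') by module, norm_smul, Real.norm_eq_abs,
      abs_of_pos hr.1] at h3
    linarith
  have e1 : ‖x - β • g - x'‖ ^ 2 = ‖x - x'‖ ^ 2 - 2 * β * inner ℝ g (x - x') + ‖β • g‖ ^ 2 := by
    rw [show x - β • g - x' = (x - x') - β • g by abel, norm_sub_sq_real, real_inner_smul_right,
      real_inner_comm]
    ring
  have e2 : ‖x - β • g - z‖ ^ 2 = ‖x - z‖ ^ 2 + 2 * β * inner ℝ g (z - x) + ‖β • g‖ ^ 2 := by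
    rw [show x - β • g - z = (x - z) - β • g by abel, norm_sub_sq_real, real_inner_smul_right,
      real_inner_comm, ← neg_sub z x, inner_neg_right]
    ring
  rw [e1, e2] at h1
  have h2 := mul_le_mul_of_nonneg_left hg1 hβ
  have h3 := mul_le_mul_of_nonneg_left hg2 hβ
  nlinarith [sq_nonneg (β * L - ‖x - x'‖)]

end Projection

section Loss

variable {S A : Type*} [Fintype S] [Fintype A]

lemma convex_shrunkSimplex (ϱ : ℝ) : Convex ℝ (shrunkSimplex A ϱ) := by
  intro x hx y hy a b ha hb hab
  refine ⟨fun i => ?_, ?_⟩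
  · calc ϱ = a * ϱ + b * ϱ := by rw [← add_mul, hab, one_mul]
      _ ≤ a * x i + b * y i := add_le_add (mul_le_mul_of_nonneg_left (hx.1 i) ha)
          (mul_le_mul_of_nonneg_left (hy.1 i) hb)
  · simp [Finset.sum_add_distrib, ← Finset.mul_sum, hx.2, hy.2, hab]

lemma convex_shrunkPolicies (ϱ : ℝ) : Convex ℝ (shrunkPolicies S A ϱ) :=
  fun _ hx _ hy _ _ ha hb hab s => convex_shrunkSimplex ϱ (hx s) (hy s) ha hb hab

lemma differentiableAt_expectedKL (ν : S → ℝ) {π φ : Table S A} (hφ : ∀ s a, 0 < φ s a) :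
    DifferentiableAt ℝ (expectedKL ν π) φ := by
  unfold expectedKL klDist
  refine DifferentiableAt.fun_sum fun s _ => (DifferentiableAt.fun_sum fun a _ => ?_).const_mul _
  have h1 : DifferentiableAt ℝ (fun y : Table S A => y s a) φ :=
    (EuclideanSpace.proj a ∘L PiLp.proj 2 (fun _ : S => EuclideanSpace ℝ A) s :
      Table S A →L[ℝ] ℝ).differentiableAt
  rcases eq_or_ne (π s a) 0 with h | h
  · simp [h]
  · have h2 : DifferentiableAt ℝ (fun y : Table S A => π s a / y s a) φ := by
      simp only [div_eq_mul_inv]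
      exact (h1.fun_inv (hφ s a).ne').const_mul _
    exact (h2.log (div_ne_zero h (hφ s a).ne')).const_mul (π s a)

lemma convexOn_klDist {ϱ : ℝ} (hϱ : 0 < ϱ) {q : EuclideanSpace ℝ A} (hq : ∀ a, 0 ≤ q a) :
    ConvexOn ℝ (shrunkSimplex A ϱ) (klDist q) := by
  refine ⟨convex_shrunkSimplex ϱ, fun x hx y hy a b ha hb hab => ?_⟩
  have hz := convex_shrunkSimplex ϱ hx hy ha hb hab
  have hx' : ∀ i, 0 < x i := fun i => hϱ.trans_le (hx.1 i)
  have hy' : ∀ i, 0 < y i := fun i => hϱ.trans_le (hy.1 i)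
  have hz' : ∀ i, 0 < (a • x + b • y) i := fun i => hϱ.trans_le (hz.1 i)
  have hlog : ∀ i, a * Real.log (x i) + b * Real.log (y i) ≤ Real.log ((a • x + b • y) i) :=
    fun i => strictConcaveOn_log_Ioi.concaveOn.2 (hx' i) (hy' i) ha hb hab
  have e1 := klDist_sub_klDist (q := q) hx' hz'
  have e2 := klDist_sub_klDist (q := q) hy' hz'
  have h : 0 ≤ a * (klDist q x - klDist q (a • x + b • y)) +
      b * (klDist q y - klDist q (a • x + b • y)) := by
    rw [e1, e2, Finset.mul_sum, Finset.mul_sum, ← Finset.sum_add_distrib]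
    refine Finset.sum_nonneg fun i _ => ?_
    have h2 := mul_nonneg (hq i) (sub_nonneg.2 (hlog i))
    have e3 : a * (q i * (Real.log ((a • x + b • y) i) - Real.log (x i))) +
        b * (q i * (Real.log ((a • x + b • y) i) - Real.log (y i))) =
        q i * ((a + b) * Real.log ((a • x + b • y) i) -
          (a * Real.log (x i) + b * Real.log (y i))) := by ring
    rwa [e3, hab, one_mul]
  rw [smul_eq_mul, smul_eq_mul]
  have e4 : klDist q (a • x + b • y) = (a + b) * klDist q (a • x + b • y) := by rw [hab, one_mul]
  rw [e4]
  linarith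

lemma convexOn_expectedKL {ϱ : ℝ} (hϱ : 0 < ϱ) {ν : S → ℝ} (hν : ∀ s, 0 ≤ ν s) {π : Table S A}
    (hπ : π ∈ shrunkPolicies S A 0) :
    ConvexOn ℝ (shrunkPolicies S A ϱ) (expectedKL ν π) := by
  refine ⟨convex_shrunkPolicies ϱ, fun x hx y hy a b ha hb hab => ?_⟩
  simp only [expectedKL, smul_eq_mul, Finset.mul_sum]
  rw [← Finset.sum_add_distrib]
  refine Finset.sum_le_sum fun s _ => ?_
  have h := (convexOn_klDist hϱ (hπ s).1).2 (hx s) (hy s) ha hb hab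
  have := mul_le_mul_of_nonneg_left h (hν s)
  simp only [smul_eq_mul] at this
  calc _ ≤ _ := this
    _ = _ := by ring

lemma expectedKL_sub_le {ϱ L L' : ℝ} (hL : 0 ≤ L) {ν : S → ℝ} (hν : ∀ s, 0 ≤ ν s)
    (hν1 : ∑ s, ν s = 1) {π φ ψ : Table S A} (hreg : ∀ s, KLRegular ϱ L L' (π s))
    (hφ : φ ∈ shrunkPolicies S A ϱ) (hψ : ψ ∈ shrunkPolicies S A ϱ) :
    expectedKL ν π φ - expectedKL ν π ψ ≤ L * ‖φ - ψ‖ := by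
  rw [expectedKL, expectedKL, ← Finset.sum_sub_distrib]
  calc _ ≤ ∑ s, ν s * (L * ‖φ - ψ‖) := by
        refine Finset.sum_le_sum fun s _ => ?_
        rw [← mul_sub]
        refine mul_le_mul_of_nonneg_left ?_ (hν s)
        refine (le_abs_self _).trans (((hreg s _ (hφ s) _ (hψ s)).1).trans ?_)
        exact mul_le_mul_of_nonneg_left (PiLp.norm_apply_le (φ - ψ) s) hL
    _ = _ := by rw [← Finset.sum_mul, hν1, one_mul]

end Loss

/-! ### One run of CRPO -/

section CRPO

variable {S A : Type*} [Fintype S] [Fintype A] {p : ℕ}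

lemma CMDP.nonempty_state (C : CMDP S A p) : Nonempty S := by
  by_contra h
  rw [not_nonempty_iff] at h
  have := C.init_sum
  simp at this

lemma nonempty_action [Nonempty S] {ϱ : ℝ} {π : Table S A} (hπ : π ∈ shrunkPolicies S A ϱ) :
    Nonempty A := by
  by_contra h
  rw [not_nonempty_iff] at h
  have := (hπ (Classical.arbitrary S)).2
  simp at this

lemma stepConstant_pos [Nonempty S] [Nonempty A] {γ : ℝ} (hγ1 : γ < 1) :
    0 < stepConstant S A γ := by
  have : 0 < 1 - γ := sub_pos.2 hγ1
  exact lt_max_of_lt_right (by positivity)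

/-- A natural policy gradient step of signed size `σ` on `J_i`: the progress of the divergence from
`π` is at least the gap between the values, up to a second-order term. -/
lemma policy_step [Nonempty A] (C : CMDP S A p) {γ : ℝ} (hγ0 : 0 ≤ γ)
    (hγ1 : γ < 1) {π : Table S A} (hπ : π ∈ shrunkPolicies S A 0) (i : Fin (p + 1)) (σ : ℝ)
    {θ θ' : S → A → ℝ}
    (h : ∀ s a, θ' s a = θ s a + σ * (C.actionValue γ (softmax θ) i s a / (1 - γ))) :
    σ * (C.totalValue γ π i - C.totalValue γ (softmax θ) i) ≤
      expectedKL (C.visitation γ π) π (softmax θ) - expectedKL (C.visitation γ π) π (softmax θ') +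
        2 * σ ^ 2 * stepConstant S A γ := by
  have hpos : 0 < 1 - γ := sub_pos.2 hγ1
  have hν := C.visitation_nonneg hγ0 hγ1 hπ
  set δ := σ / (1 - γ) with hδ
  have hΔ : ∀ s a, θ' s a - θ s a = δ * C.actionValue γ (softmax θ) i s a := fun s a => by
    rw [h, hδ]
    ring
  have hmem : ∀ s a, θ' s a - θ s a ∈ Set.Icc (min 0 (δ * (1 / (1 - γ))))
      (max 0 (δ * (1 / (1 - γ)))) := by
    intro s a
    have hQ := C.actionValue_mem_Icc hγ0 hγ1 (softmax_mem_shrunkPolicies θ) i s a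
    rw [hΔ]
    rcases le_total 0 δ with hs | hs
    · exact ⟨min_le_of_left_le (mul_nonneg hs hQ.1),
        le_max_of_le_right (mul_le_mul_of_nonneg_left hQ.2 hs)⟩
    · exact ⟨min_le_of_right_le (mul_le_mul_of_nonpos_left hQ.2 hs),
        le_max_of_le_left (mul_nonpos_of_nonpos_of_nonneg hs hQ.1)⟩
  have hlen : (max 0 (δ * (1 / (1 - γ))) - min 0 (δ * (1 / (1 - γ)))) ^ 2 / 8 =
      2 * σ ^ 2 * (1 / (16 * (1 - γ) ^ 4)) := by
    rw [max_sub_min_eq_abs, sq_abs, hδ]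
    field_simp
    ring
  have hsum := Finset.sum_le_sum fun s (_ : s ∈ Finset.univ) => mul_le_mul_of_nonneg_left
    (sum_sub_mul_le_klDist_sub_klDist (hπ s).2 s (hmem s)) (hν s)
  have e1 : ∑ s, C.visitation γ π s * ∑ a, (π s a - softmax θ s a) * (θ' s a - θ s a) =
      σ * (C.totalValue γ π i - C.totalValue γ (softmax θ) i) := by
    have e2 := C.totalValue_sub_totalValue hγ0 hγ1 hπ (softmax_mem_shrunkPolicies θ) i
    calc _ = δ * ∑ s, C.visitation γ π s *
          ∑ a, (π s a - softmax θ s a) * C.actionValue γ (softmax θ) i s a := by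
          simp only [hΔ, Finset.mul_sum]
          exact Finset.sum_congr rfl fun s _ => Finset.sum_congr rfl fun a _ => by ring
      _ = _ := by rw [e2, hδ]; field_simp
  simp only [mul_sub (C.visitation γ π _), Finset.sum_sub_distrib, e1, hlen, ← Finset.sum_mul,
    C.sum_visitation hγ0 hγ1 hπ, one_mul] at hsum
  have hκ : 1 / (16 * (1 - γ) ^ 4) ≤ stepConstant S A γ := le_max_right _ _
  have := mul_le_mul_of_nonneg_left hκ (show 0 ≤ 2 * σ ^ 2 by positivity)
  simp only [expectedKL]
  linarith

/-- Summed over a run of CRPO: the optimality gaps at the reward steps and, for each constraint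
step, the tolerance, are paid for by the initial divergence and the second-order terms. -/
lemma sum_policy_steps_le [Nonempty A] (C : CMDP S A p) {γ : ℝ} (hγ0 : 0 ≤ γ)
    (hγ1 : γ < 1) {π : Table S A} (hπ : π ∈ shrunkPolicies S A 0) {α : ℝ} {M : ℕ}
    {θ : ℕ → S → A → ℝ} {g : ℕ → ℝ} (hg : ∀ m < M, ∃ i : Fin (p + 1), ∃ σ : ℝ, σ ^ 2 = α ^ 2 ∧
      g m ≤ σ * (C.totalValue γ π i - C.totalValue γ (softmax (θ m)) i) ∧
      ∀ s a, θ (m + 1) s a = θ m s a + σ * (C.actionValue γ (softmax (θ m)) i s a / (1 - γ))) :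
    ∑ m ∈ Finset.range M, g m ≤
      expectedKL (C.visitation γ π) π (softmax (θ 0)) + 2 * M * α ^ 2 * stepConstant S A γ := by
  have h : ∀ m ∈ Finset.range M, g m ≤ expectedKL (C.visitation γ π) π (softmax (θ m)) -
      expectedKL (C.visitation γ π) π (softmax (θ (m + 1))) +
        2 * α ^ 2 * stepConstant S A γ := by
    intro m hm
    obtain ⟨i, σ, hσ, hgm, hθ⟩ := hg m (Finset.mem_range.1 hm)
    rw [← hσ]
    exact hgm.trans (policy_step C hγ0 hγ1 hπ i σ hθ)
  have h2 := Finset.sum_le_sum h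
  rw [Finset.sum_add_distrib,
    Finset.sum_range_sub' fun m => expectedKL (C.visitation γ π) π (softmax (θ m)),
    Finset.sum_const, Finset.card_range, nsmul_eq_mul] at h2
  have h3 := expectedKL_nonneg (C.visitation_nonneg hγ0 hγ1 hπ) hπ (softmax_pos (θ M))
    (sum_softmax (θ M))
  linarith

/-- The guarantee of CRPO in one task: if the tolerance `η` is large enough then there are reward
steps, and the expected output is optimal up to `η` and violates the constraints by at most `η`. -/
lemma IsCRPO.guarantee [Nonempty A] {C : CMDP S A p} {γ : ℝ} (hγ0 : 0 ≤ γ)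
    (hγ1 : γ < 1) {π : Table S A} (hπ : C.IsFeasible γ π) {α η : ℝ} {M : ℕ} (hM : 0 < M)
    (hα : 0 < α) {θ : ℕ → S → A → ℝ} (h : IsCRPO C γ α η M θ)
    (hη : expectedKL (C.visitation γ π) π (softmax (θ 0)) + 2 * M * α ^ 2 * stepConstant S A γ ≤
      α * M * η) :
    (rewardSteps C γ η M θ).Nonempty ∧
      C.totalValue γ π 0 - expectedOutputValue C γ η M θ 0 ≤ η ∧
      ∀ i : Fin p, expectedOutputValue C γ η M θ i.succ - C.limit i ≤ η := by
  classical
  have hmem : ∀ m, m ∈ rewardSteps C γ η M θ ↔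
      m < M ∧ WithinTolerance C γ η (softmax (θ m)) := fun m => by simp [rewardSteps]
  have hgap : ∀ m < M, ¬ WithinTolerance C γ η (softmax (θ m)) →
      ∃ i : Fin (p + 1), η < C.totalValue γ (softmax (θ m)) i - C.totalValue γ π i ∧
        ∀ s a, θ (m + 1) s a =
          θ m s a + (-α) * (C.actionValue γ (softmax (θ m)) i s a / (1 - γ)) := by
    intro m hm hm'
    obtain ⟨i, hi, hθ⟩ := h.constraint_step m hm hm'
    refine ⟨i.succ, by linarith [hπ.2 i], fun s a => ?_⟩
    rw [hθ]
    ring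
  -- Each constraint step costs strictly more than `α η`, and `M` of them exceed the budget.
  have hne : (rewardSteps C γ η M θ).Nonempty := by
    by_contra hne
    rw [Finset.not_nonempty_iff_eq_empty] at hne
    have hall : ∀ m < M, ¬ WithinTolerance C γ η (softmax (θ m)) := fun m hm hm' => by
      have := (hmem m).2 ⟨hm, hm'⟩
      simp [hne] at this
    choose! i hi hθ using fun m hm => hgap m hm (hall m hm)
    have h1 := sum_policy_steps_le C hγ0 hγ1 hπ.1 (α := α) (θ := θ) (M := M)
      (g := fun m => α * (C.totalValue γ (softmax (θ m)) (i m) - C.totalValue γ π (i m)))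
      fun m hm => ⟨i m, -α, by ring, by linarith, hθ m hm⟩
    have h2 : ∑ _m ∈ Finset.range M, α * η < ∑ m ∈ Finset.range M,
        α * (C.totalValue γ (softmax (θ m)) (i m) - C.totalValue γ π (i m)) :=
      Finset.sum_lt_sum_of_nonempty (Finset.nonempty_range_iff.2 hM.ne') fun m hm =>
        mul_lt_mul_of_pos_left (hi m (Finset.mem_range.1 hm)) hα
    rw [Finset.sum_const, Finset.card_range, nsmul_eq_mul] at h2
    linarith
  have hcard : (0 : ℝ) < (rewardSteps C γ η M θ).card := by exact_mod_cast hne.card_pos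
  refine ⟨hne, ?_, fun i => ?_⟩
  · have h1 := sum_policy_steps_le C hγ0 hγ1 hπ.1 (α := α) (θ := θ) (M := M)
      (g := fun m => if WithinTolerance C γ η (softmax (θ m)) then
        α * (C.totalValue γ π 0 - C.totalValue γ (softmax (θ m)) 0) else α * η) fun m hm => by
        by_cases hm' : WithinTolerance C γ η (softmax (θ m))
        · exact ⟨0, α, rfl, by simp [hm'], h.reward_step m hm hm'⟩
        · obtain ⟨i, hi, hθ⟩ := hgap m hm hm'
          refine ⟨i, -α, by ring, ?_, hθ⟩
          have := mul_le_mul_of_nonneg_left hi.le hα.le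
          simp only [hm', if_false]
          linarith
    -- Both the gaps at reward steps and the constant `η` are compared over all `M` steps, so that
    -- the constraint steps cancel.
    have h2 : ∑ m ∈ Finset.range M, ((if WithinTolerance C γ η (softmax (θ m)) then
        α * (C.totalValue γ π 0 - C.totalValue γ (softmax (θ m)) 0) else α * η) - α * η) ≤ 0 := by
      rw [Finset.sum_sub_distrib, Finset.sum_const, Finset.card_range, nsmul_eq_mul]
      linarith
    have h3 : ∑ m ∈ Finset.range M, ((if WithinTolerance C γ η (softmax (θ m)) then
        α * (C.totalValue γ π 0 - C.totalValue γ (softmax (θ m)) 0) else α * η) - α * η) =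
        α * ∑ m ∈ rewardSteps C γ η M θ,
          (C.totalValue γ π 0 - η - C.totalValue γ (softmax (θ m)) 0) := by
      rw [rewardSteps, Finset.sum_filter, Finset.mul_sum]
      refine Finset.sum_congr rfl fun m _ => ?_
      split_ifs <;> ring
    rw [h3] at h2
    have h4 := nonpos_of_mul_nonpos_right h2 hα
    rw [Finset.sum_sub_distrib, Finset.sum_const, nsmul_eq_mul] at h4
    have h5 : C.totalValue γ π 0 - η ≤ expectedOutputValue C γ η M θ 0 := by
      rw [expectedOutputValue, le_div_iff₀ hcard]
      linarith
    linarith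
  · have h1 : expectedOutputValue C γ η M θ i.succ ≤ C.limit i + η := by
      rw [expectedOutputValue, div_le_iff₀ hcard, mul_comm, ← nsmul_eq_mul]
      exact Finset.sum_le_card_nsmul _ _ _ fun m hm => ((hmem m).1 hm).2 i
    linarith

end CRPO

/-! ### Regret of the initializations and the final rate -/

section Meta

variable {S A : Type*} [Fintype S] [Fintype A] {p : ℕ}

lemma pos_of_mem_shrunkPolicies {ϱ : ℝ} (hϱ : 0 < ϱ) {π : Table S A}
    (hπ : π ∈ shrunkPolicies S A ϱ) (s : S) (a : A) : 0 < π s a :=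
  hϱ.trans_le ((hπ s).1 a)

/-- The regret of projected online gradient descent on the estimated losses, before the choice of
the step size. -/
lemma IsMetaRun.regret_le {T M : ℕ} {tasks : Fin T → CMDP S A p} {γ ϱ α β : ℝ} {η : Fin T → ℝ}
    {φ : ℕ → Table S A} {θ : Fin T → ℕ → S → A → ℝ} {πhat : Fin T → Table S A}
    {νhat : Fin T → S → ℝ} (h : IsMetaRun tasks γ ϱ α β η M φ θ πhat νhat) (hϱ : 0 < ϱ)
    (hβ : 0 ≤ β) {L L' : ℝ} (hL : 0 ≤ L) (hreg : ∀ t s, KLRegular ϱ L L' (πhat t s))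
    (hφ : ∀ t : Fin T, φ t ∈ shrunkPolicies S A ϱ)
    {ψ : Table S A} (hψ : ψ ∈ shrunkPolicies S A ϱ) :
    2 * β * ∑ t : Fin T, (expectedKL (νhat t) (πhat t) (φ t) - expectedKL (νhat t) (πhat t) ψ) ≤
      ‖ψ‖ ^ 2 + T * (β ^ 2 * L ^ 2) := by
  have hX := convex_shrunkPolicies (S := S) (A := A) ϱ
  have h1 : ∀ t : Fin T, 2 * β * (expectedKL (νhat t) (πhat t) (φ t) -
      expectedKL (νhat t) (πhat t) ψ) ≤
      (‖φ t - ψ‖ ^ 2 - ‖φ (t + 1) - ψ‖ ^ 2) + β ^ 2 * L ^ 2 := fun t =>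
    projected_gradient_step hX hβ (hφ t) hψ
      (differentiableAt_expectedKL _ (pos_of_mem_shrunkPolicies hϱ (hφ t)))
      (fun _ hy => expectedKL_sub_le hL (h.estimate_nonneg t) (h.estimate_sum t) (hreg t) (hφ t) hy)
      (convexOn_expectedKL hϱ (h.estimate_nonneg t) (h.output_policy t)) (h.update t)
  have h2 := Finset.sum_le_sum fun t (_ : t ∈ Finset.univ) => h1 t
  rw [← Finset.mul_sum, Finset.sum_add_distrib,
    Fin.sum_univ_eq_sum_range (fun t => ‖φ t - ψ‖ ^ 2 - ‖φ (t + 1) - ψ‖ ^ 2) T,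
    Finset.sum_range_sub' fun t => ‖φ t - ψ‖ ^ 2, Finset.sum_const, Finset.card_univ,
    Fintype.card_fin, nsmul_eq_mul] at h2
  have h3 := h.first.norm_sub_sq_le hX hψ
  simp only [zero_sub, norm_neg] at h3
  nlinarith [sq_nonneg ‖φ T - ψ‖, sq_nonneg ‖φ 0‖]

end Meta

end MetaSRL

theorem theorem2 {S A : Type*} [Fintype S] [Fintype A] (p T M : ℕ) (hT : 0 < T) (hM : 0 < M)
    (γ : ℝ) (hγ0 : 0 ≤ γ) (hγ1 : γ < 1) (ϱ : ℝ) (hϱ : 0 < ϱ)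
    -- the tasks and their optimal policies
    (tasks : Fin T → MetaSRL.CMDP S A p) (πstar : Fin T → MetaSRL.Table S A)
    (hopt : ∀ t, (tasks t).IsOptimal γ (πstar t))
    -- a realization of the algorithm
    (lam : ℝ) (hlam : 1 ≤ lam) (α β : ℝ) (η : Fin T → ℝ)
    (φ : ℕ → MetaSRL.Table S A) (θ : Fin T → ℕ → S → A → ℝ)
    (πhat : Fin T → MetaSRL.Table S A) (νhat : Fin T → S → ℝ)
    (hrun : MetaSRL.IsMetaRun tasks γ ϱ α β η M φ θ πhat νhat)
    -- the inexactness of the estimated losses in each task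
    (ε : Fin T → ℝ)
    (hε : ∀ t, ∀ ψ ∈ MetaSRL.shrunkPolicies S A ϱ,
      |MetaSRL.expectedKL ((tasks t).visitation γ (πstar t)) (πstar t) ψ
        - MetaSRL.expectedKL (νhat t) (πhat t) ψ| ≤ ε t)
    -- Lipschitz and smoothness constants of the divergence
    (Lg Lpi C₁ : ℝ) (hLg : 0 < Lg) (hLpi : 0 < Lpi) (hC₁ : 0 < C₁) (hC₁' : C₁ < 2 / Lpi)
    (hreg : ∀ t s, MetaSRL.KLRegular ϱ Lg Lpi (πstar t s) ∧
      MetaSRL.KLRegular ϱ Lg Lpi (πhat t s))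
    -- the best fixed initial policy in hindsight
    (φstar : MetaSRL.Table S A) (hφstar : φstar ∈ MetaSRL.shrunkPolicies S A ϱ)
    (hmin : IsMinOn (MetaSRL.averageLoss νhat πhat) (MetaSRL.shrunkPolicies S A ϱ) φstar)
    -- the tuning of the parameters
    (B κ : ℝ)
    (hB : B = MetaSRL.rateBound T Lg Lpi C₁ ‖φstar‖ (∑ t, ε t)
      (MetaSRL.empiricalSimilaritySq ϱ νhat πhat))
    (hκ : κ = MetaSRL.stepConstant S A γ)
    (hη : ∀ t, η t = MetaSRL.tolerance (tasks t) γ α κ lam M (πstar t) (φ t))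
    (hα : α = √(B / (2 * M * κ)))
    (hβ : β = ‖φstar‖ / (Lg * √(2 * (T : ℝ)))) :
    (∀ t, (MetaSRL.rewardSteps (tasks t) γ (η t) M (θ t)).Nonempty) ∧
    (1 / (T : ℝ)) * ∑ t, ((tasks t).totalValue γ (πstar t) 0
        - MetaSRL.expectedOutputValue (tasks t) γ (η t) M (θ t) 0)
      ≤ lam * (√(8 * κ) / √(M : ℝ) * √B) ∧
    ∀ i : Fin p,
      (1 / (T : ℝ)) * ∑ t, (MetaSRL.expectedOutputValue (tasks t) γ (η t) M (θ t) i.succ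
          - (tasks t).limit i)
        ≤ lam * (√(8 * κ) / √(M : ℝ) * √B) := by
  open MetaSRL in
  have hTpos : (0 : ℝ) < T := Nat.cast_pos.2 hT
  have hMpos : (0 : ℝ) < M := Nat.cast_pos.2 hM
  have : Nonempty S := (tasks ⟨0, hT⟩).nonempty_state
  have : Nonempty A := nonempty_action hφstar
  have hκpos : 0 < κ := hκ ▸ stepConstant_pos hγ1
  have hφ : ∀ t : Fin T, φ t ∈ shrunkPolicies S A ϱ := by
    rintro ⟨t, ht⟩
    cases t with
    | zero => exact hrun.first.1
    | succ t => exact (hrun.update ⟨t, by omega⟩).1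
  have hb : 0 < ‖φstar‖ := by
    rw [norm_pos_iff]
    rintro rfl
    have := pos_of_mem_shrunkPolicies hϱ hφstar (Classical.arbitrary S) (Classical.arbitrary A)
    simp at this
  set b := ‖φstar‖ with hbdef
  have hE : 0 ≤ ∑ t, ε t := Finset.sum_nonneg fun t _ => (abs_nonneg _).trans (hε t _ hφstar)
  have hsim : empiricalSimilaritySq ϱ νhat πhat = averageLoss νhat πhat φstar :=
    IsLeast.csInf_eq ⟨⟨φstar, hφstar, rfl⟩, by rintro _ ⟨ψ, hψ, rfl⟩; exact hmin hψ⟩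
  have hsim0 : 0 ≤ averageLoss νhat πhat φstar :=
    mul_nonneg (by positivity) <| Finset.sum_nonneg fun t _ =>
      expectedKL_nonneg (hrun.estimate_nonneg t) (hrun.output_policy t)
        (pos_of_mem_shrunkPolicies hϱ hφstar) fun s => (hφstar s).2
  have hcoef : 0 ≤ 4 * √2 * Lg * Lpi * b / ((2 * C₁ - C₁ ^ 2 * Lpi) * √(T : ℝ)) := by
    have : 0 < 2 * C₁ - C₁ ^ 2 * Lpi := by
      rw [lt_div_iff₀ hLpi] at hC₁'
      nlinarith
    positivity
  have hBlower : √2 * Lg * b / √(T : ℝ) + (∑ t, ε t) / T + averageLoss νhat πhat φstar ≤ B := by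
    rw [hB, rateBound, hsim]
    have : (∑ t, ε t) / T ≤
        (2 + 4 * √2 * Lg * Lpi * b / ((2 * C₁ - C₁ ^ 2 * Lpi) * √(T : ℝ))) * ((∑ t, ε t) / T) :=
      le_mul_of_one_le_left (by positivity) (by linarith)
    linarith
  have hBpos : 0 < B := by
    have h1 : 0 < √2 * Lg * b / √(T : ℝ) := by positivity
    have h2 : 0 ≤ (∑ t, ε t) / T := by positivity
    linarith
  -- Without `0 < B` the learning rate and the tolerances would degenerate to `0`.
  have hαpos : 0 < α := by
    rw [hα]
    positivity
  have hα2 : 2 * M * α ^ 2 * κ = B := by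
    rw [hα, Real.sq_sqrt (by positivity)]
    field_simp
  -- The average divergence of the optimal policies from the initializations is at most `B`.
  have hdiv : (1 / (T : ℝ)) * ∑ t, expectedKL ((tasks t).visitation γ (πstar t)) (πstar t) (φ t) ≤
      B := by
    refine le_trans ?_ hBlower
    have hβpos : 0 < β := by
      rw [hβ]
      positivity
    have h1 := hrun.regret_le hϱ hβpos.le hLg.le (fun t s => (hreg t s).2) hφ hφstar
    rw [Finset.sum_sub_distrib] at h1
    have h2 : ∑ t, expectedKL ((tasks t).visitation γ (πstar t)) (πstar t) (φ t) ≤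
        ∑ t : Fin T, expectedKL (νhat t) (πhat t) (φ t) + ∑ t, ε t := by
      rw [← Finset.sum_add_distrib]
      exact Finset.sum_le_sum fun t _ => by linarith [(abs_le.1 (hε t _ (hφ t))).2]
    have h3 : ∑ t : Fin T, expectedKL (νhat t) (πhat t) (φ t) -
        ∑ t, expectedKL (νhat t) (πhat t) φstar ≤ √2 * Lg * b * √(T : ℝ) := by
      have h2T : √(2 * (T : ℝ)) = √2 * √(T : ℝ) := Real.sqrt_mul (by norm_num) _
      have hs2 : √2 ^ 2 = (2 : ℝ) := Real.sq_sqrt (by norm_num)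
      have hsT : √(T : ℝ) ^ 2 = T := Real.sq_sqrt hTpos.le
      have hs2pos : (0 : ℝ) < √2 := by positivity
      have hsTpos : 0 < √(T : ℝ) := by positivity
      have e1 : T * (β ^ 2 * Lg ^ 2) = b ^ 2 / 2 := by
        rw [hβ, h2T]
        field_simp
        rw [hs2, hsT]
        ring
      have e2 : 2 * β * (√2 * Lg * b * √(T : ℝ)) = 2 * b ^ 2 := by
        rw [hβ, h2T]
        field_simp
      -- The step size gives `3 / (2 √2)` in place of the constant `√2 = 4 / (2 √2)`.
      rw [e1] at h1
      refine le_of_mul_le_mul_left (h1.trans ?_) (show 0 < 2 * β by positivity)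
      rw [e2]
      nlinarith
    have h4 : √2 * Lg * b / √(T : ℝ) = 1 / T * (√2 * Lg * b * √(T : ℝ)) := by
      have hsT : √(T : ℝ) ^ 2 = T := Real.sq_sqrt hTpos.le
      have hsTpos : 0 < √(T : ℝ) := by positivity
      field_simp
      rw [hsT]
    rw [h4, averageLoss, div_eq_mul_one_div (∑ t, ε t) (T : ℝ), mul_comm (∑ t, ε t) _, ← mul_add,
      ← mul_add]
    exact mul_le_mul_of_nonneg_left (by linarith) (by positivity)
  have hηavg : (1 / (T : ℝ)) * ∑ t, η t ≤ lam * (√(8 * κ) / √(M : ℝ) * √B) := by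
    have e1 : (1 / (T : ℝ)) * ∑ t, η t = lam / (α * M) *
        ((1 / (T : ℝ)) * ∑ t, expectedKL ((tasks t).visitation γ (πstar t)) (πstar t) (φ t) + B) := by
      simp only [hη, tolerance, hα2]
      rw [← Finset.mul_sum, Finset.sum_add_distrib, Finset.sum_const, Finset.card_univ,
        Fintype.card_fin, nsmul_eq_mul]
      field_simp
    have e2 : lam / (α * M) * (B + B) = lam * (√(8 * κ) / √(M : ℝ) * √B) := by
      have e3 : √(8 * κ) / √(M : ℝ) * √B = 2 * B / (α * M) := by
        rw [← Real.sqrt_div (by positivity), ← Real.sqrt_mul (by positivity),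
          Real.sqrt_eq_iff_mul_self_eq (by positivity) (by positivity)]
        rw [← hα2]
        field_simp
        ring
      rw [e3]
      ring
    rw [e1, ← e2]
    exact mul_le_mul_of_nonneg_left (by linarith) (by positivity)
  have hguar := fun t => (hrun.within_task t).guarantee hγ0 hγ1 (hopt t).1 hM hαpos (by
    rw [hrun.start t, ← hκ, hη t, tolerance]
    have h0 : 0 ≤ expectedKL ((tasks t).visitation γ (πstar t)) (πstar t) (φ t) :=
      expectedKL_nonneg ((tasks t).visitation_nonneg hγ0 hγ1 (hopt t).1.1) (hopt t).1.1
        (pos_of_mem_shrunkPolicies hϱ (hφ t)) fun s => (hφ t s).2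
    have e : α * M * (lam / (α * M) *
        (expectedKL ((tasks t).visitation γ (πstar t)) (πstar t) (φ t) + 2 * M * α ^ 2 * κ)) =
        lam * (expectedKL ((tasks t).visitation γ (πstar t)) (πstar t) (φ t) +
          2 * M * α ^ 2 * κ) := by
      field_simp
    rw [e]
    exact le_mul_of_one_le_left (by positivity) hlam)
  exact ⟨fun t => (hguar t).1,
    (mul_le_mul_of_nonneg_left (Finset.sum_le_sum fun t _ => (hguar t).2.1)
      (by positivity)).trans hηavg,
    fun i => (mul_le_mul_of_nonneg_left (Finset.sum_le_sum fun t _ => (hguar t).2.2 i)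
      (by positivity)).trans hηavg⟩
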